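/- Let $n \ge 0$, let $L=\{0,1,\cdot,+,-,(\,)^{-1},\sigma_1,\dots,\sigma_n,\sigma_1^{-1},\dots,\sigma_n^{-1}\}$, and let $T$ be the first-order $L$-theory of fields (with $0^{-1}=0$) with pairwise commuting automorphisms $\sigma_1,\dots,\sigma_n$ whose inverses are $\sigma_1^{-1},\dots,\sigma_n^{-1}$. A model $\mathfrak A\models T$ is called a relatively algebraically closed model of $T$ if for every $\mathfrak B\models T$ with $\mathfrak A\subseteq\mathfrak B$, every root in $\mathfrak B$ of a non-zero polynomial in one variable with coefficients from $\mathfrak A$ lies in $\mathfrak A$. Let $\mathfrak A$ be a relatively algebraically closed model of $T$, and let $\mathfrak A_0=acl_\sigma^{\mathfrak A}(\emptyset)$ be the smallest subfield of $\mathfrak A$ that is closed under all $\sigma_i$ and $\sigma_i^{-1}$ and relatively algebraically closed (as a field) in $\mathfrak A$. Let $\mathcal K=\mathcal K_{\mathfrak A_0}$ be the FCA-class determined by $\mathfrak A_0$: its members are the relatively algebraically closed models of $T$ that contain (a copy of) $\mathfrak A_0$, and for $\mathfrak B,\mathfrak C\in\mathcal K$ one puts $\mathfrak B\preccurlyeq\mathfrak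 C$ if $\mathfrak B\subseteq\mathfrak C$. A strong embedding $f:\mathfrak B\to\mathfrak C$ is an isomorphism of $\mathfrak B$ onto a substructure $f(\mathfrak B)\preccurlyeq\mathfrak C$. Then: 1. $\mathfrak A_0\in\mathcal K$. 2. $\mathcal K$ has amalgamation over $\mathfrak A_0$: if $\mathfrak B,\mathfrak C\in\mathcal K$ and $f:\mathfrak A_0\to\mathfrak B$, $f':\mathfrak A_0\to\mathfrak C$ are strong embeddings, then there are $\mathfrak D\in\mathcal K$ and strong embeddings $g:\mathfrak B\to\mathfrak D$, $g':\mathfrak C\to\mathfrak D$ with $g\circ f=g'\circ f'$. 3. $\mathcal K$ has the joint embedding property: for all $\mathfrak B,\mathfrak C\in\mathcal K$ there are $\mathfrak D\in\mathcal K$ and strong embeddings $\mathfrak B\to\mathfrak D$ and $\mathfrak C\to\mathfrak D$. -/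

import Mathlib

universe u

/-! ### Classes of structures with a strong-substructure relation -/

namespace FCA

open FirstOrder FirstOrder.Language FirstOrder.Language.Structure CategoryTheory

/-- A class `(𝒦, ≼)` of `L`-structures. Since `𝔄 ≼ 𝔅` is only considered when `𝔄` is a
substructure of `𝔅`, the relation is recorded as a predicate on the substructures of `𝔅`:
`Strong 𝔅 S` means `S ≼ 𝔅`. -/
structure AbstractClass (L : FirstOrder.Language.{0, 0}) where
  /-- the members of the class -/
  carrier : Set (Bundled.{u} L.Structure)
  /-- `Strong 𝔅 S` means that the substructure `S` of `𝔅` is a strong substructure -/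
  Strong : ∀ B : Bundled.{u} L.Structure, L.Substructure B → Prop

namespace AbstractClass

variable {L : FirstOrder.Language.{0, 0}} (K : AbstractClass.{u} L)

/-- A map `f : 𝔄 → 𝔅` is a strong embedding if it is an isomorphism onto its image (that is, an
embedding of `L`-structures) and its image is a strong substructure of `𝔅`. -/
def IsStrongEmbedding {A B : Bundled.{u} L.Structure} (f : A ↪[L] B) : Prop :=
  K.Strong B f.toHom.range

/-- The joint embedding property. -/
def JointEmbeddingProperty : Prop :=
  ∀ A ∈ K.carrier, ∀ B ∈ K.carrier,
    ∃ C ∈ K.carrier, ∃ (f : A ↪[L] C) (g : B ↪[L] C),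
      K.IsStrongEmbedding f ∧ K.IsStrongEmbedding g

/-- Amalgamation over a fixed structure `𝔠`: whenever `𝔠` is strongly embedded into two members
`𝔄`, `𝔅` of the class, these have strong embeddings into a member of the class that
agree on `𝔠`. -/
def AmalgamatesOver (C : Bundled.{u} L.Structure) : Prop :=
  ∀ A ∈ K.carrier, ∀ B ∈ K.carrier, ∀ (f : C ↪[L] A) (f' : C ↪[L] B),
    K.IsStrongEmbedding f → K.IsStrongEmbedding f' →
      ∃ D ∈ K.carrier, ∃ (g : A ↪[L] D) (g' : B ↪[L] D),
        K.IsStrongEmbedding g ∧ K.IsStrongEmbedding g' ∧ g.comp f = g'.comp f'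

end AbstractClass

/-! ### The theory of fields with `n` commuting automorphisms -/

/-- The function symbols `0, 1, ·, +, -, ( )⁻¹, σ₁, …, σₙ, σ₁⁻¹, …, σₙ⁻¹`. -/
inductive Func (n : ℕ) : ℕ → Type
  | zero : Func n 0
  | one : Func n 0
  | mul : Func n 2
  | add : Func n 2
  | neg : Func n 1
  | inv : Func n 1
  | aut (i : Fin n) : Func n 1
  | autInv (i : Fin n) : Func n 1

/-- The language of fields with `n` automorphisms. -/
def lang (n : ℕ) : FirstOrder.Language.{0, 0} where
  Functions := Func n
  Relations := fun _ => Empty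

section Symbols

variable (n : ℕ)

/-- the symbol `0` -/
abbrev zeroFunc : (lang n).Functions 0 := Func.zero
/-- the symbol `1` -/
abbrev oneFunc : (lang n).Functions 0 := Func.one
/-- the symbol `·` -/
abbrev mulFunc : (lang n).Functions 2 := Func.mul
/-- the symbol `+` -/
abbrev addFunc : (lang n).Functions 2 := Func.add
/-- the symbol `-` -/
abbrev negFunc : (lang n).Functions 1 := Func.neg
/-- the symbol `( )⁻¹` -/
abbrev invFunc : (lang n).Functions 1 := Func.inv
variable {n}
/-- the symbol `σᵢ` -/
abbrev autFunc (i : Fin n) : (lang n).Functions 1 := Func.aut i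
/-- the symbol `σᵢ⁻¹` -/
abbrev autInvFunc (i : Fin n) : (lang n).Functions 1 := Func.autInv i

end Symbols

section Terms

variable {n : ℕ} {α : Type}

/-- the term `0` -/
abbrev tZero : (lang n).Term α := Constants.term (zeroFunc n)
/-- the term `1` -/
abbrev tOne : (lang n).Term α := Constants.term (oneFunc n)
/-- the term `s · t` -/
abbrev tMul (s t : (lang n).Term α) : (lang n).Term α := (mulFunc n).apply₂ s t
/-- the term `s + t` -/
abbrev tAdd (s t : (lang n).Term α) : (lang n).Term α := (addFunc n).apply₂ s t
/-- the term `-t` -/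
abbrev tNeg (t : (lang n).Term α) : (lang n).Term α := (negFunc n).apply₁ t
/-- the term `t⁻¹` -/
abbrev tInv (t : (lang n).Term α) : (lang n).Term α := (invFunc n).apply₁ t
/-- the term `σᵢ(t)` -/
abbrev tAut (i : Fin n) (t : (lang n).Term α) : (lang n).Term α := (autFunc i).apply₁ t
/-- the term `σᵢ⁻¹(t)` -/
abbrev tAutInv (i : Fin n) (t : (lang n).Term α) : (lang n).Term α := (autInvFunc i).apply₁ t

end Terms

/-- Names for the axioms of the theory of fields with `n` commuting automorphisms. -/
inductive Ax (n : ℕ) : Type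
  | addAssoc : Ax n
  | zeroAdd : Ax n
  | negAddCancel : Ax n
  | mulAssoc : Ax n
  | mulComm : Ax n
  | oneMul : Ax n
  | mulInvCancel : Ax n
  | invZero : Ax n
  | leftDistrib : Ax n
  | zeroNeOne : Ax n
  | autAdd (i : Fin n) : Ax n
  | autMul (i : Fin n) : Ax n
  | autAutInv (i : Fin n) : Ax n
  | autInvAut (i : Fin n) : Ax n
  | autComm (i j : Fin n) : Ax n

/-- The sentences expressing that the structure is a field (with the usual convention `0⁻¹ = 0`
for the total function symbol `( )⁻¹`), that each `σᵢ` is additive and multiplicative with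
two-sided inverse `σᵢ⁻¹`, and that the `σᵢ` commute. -/
def Ax.toSentence {n : ℕ} : Ax n → (lang n).Sentence
  | .addAssoc => ∀' ∀' ∀' (tAdd (tAdd (&0) (&1)) (&2) =' tAdd (&0) (tAdd (&1) (&2)))
  | .zeroAdd => ∀' (tAdd tZero (&0) =' &0)
  | .negAddCancel => ∀' (tAdd (tNeg (&0)) (&0) =' tZero)
  | .mulAssoc => ∀' ∀' ∀' (tMul (tMul (&0) (&1)) (&2) =' tMul (&0) (tMul (&1) (&2)))
  | .mulComm => ∀' ∀' (tMul (&0) (&1) =' tMul (&1) (&0))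
  | .oneMul => ∀' (tMul tOne (&0) =' &0)
  | .mulInvCancel => ∀' (∼(&0 =' tZero) ⟹ (tMul (&0) (tInv (&0)) =' tOne))
  | .invZero => tInv (tZero : (lang n).Term (Empty ⊕ Fin 0)) =' tZero
  | .leftDistrib =>
      ∀' ∀' ∀' (tMul (&0) (tAdd (&1) (&2)) =' tAdd (tMul (&0) (&1)) (tMul (&0) (&2)))
  | .zeroNeOne => ∼((tZero : (lang n).Term (Empty ⊕ Fin 0)) =' tOne)
  | .autAdd i => ∀' ∀' (tAut i (tAdd (&0) (&1)) =' tAdd (tAut i (&0)) (tAut i (&1)))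
  | .autMul i => ∀' ∀' (tAut i (tMul (&0) (&1)) =' tMul (tAut i (&0)) (tAut i (&1)))
  | .autAutInv i => ∀' (tAut i (tAutInv i (&0)) =' &0)
  | .autInvAut i => ∀' (tAutInv i (tAut i (&0)) =' &0)
  | .autComm i j => ∀' (tAut i (tAut j (&0)) =' tAut j (tAut i (&0)))

/-- The first-order theory `T` of fields with `n` commuting automorphisms. -/
def theory (n : ℕ) : (lang n).Theory := Set.range Ax.toSentence

/-! ### The field structure of a model of `T` -/

section Ops

variable {n : ℕ} (K : Type*) [(lang n).Structure K]

/-- The field operations that the symbols of the language define on a structure. -/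
abbrev zeroOfStructure : Zero K := ⟨funMap (zeroFunc n) ![]⟩
/-- See `zeroOfStructure`. -/
abbrev oneOfStructure : One K := ⟨funMap (oneFunc n) ![]⟩
/-- See `zeroOfStructure`. -/
abbrev mulOfStructure : Mul K := ⟨fun x y => funMap (mulFunc n) ![x, y]⟩
/-- See `zeroOfStructure`. -/
abbrev addOfStructure : Add K := ⟨fun x y => funMap (addFunc n) ![x, y]⟩
/-- See `zeroOfStructure`. -/
abbrev negOfStructure : Neg K := ⟨fun x => funMap (negFunc n) ![x]⟩
/-- See `zeroOfStructure`. -/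
abbrev invOfStructure : Inv K := ⟨fun x => funMap (invFunc n) ![x]⟩

/-- What an axiom says in terms of the operations of the structure. -/
def Ax.toProp : Ax n → Prop :=
  letI := zeroOfStructure (n := n) K
  letI := oneOfStructure (n := n) K
  letI := mulOfStructure (n := n) K
  letI := addOfStructure (n := n) K
  letI := negOfStructure (n := n) K
  letI := invOfStructure (n := n) K
  let σ : Fin n → K → K := fun i x => funMap (autFunc i) ![x]
  let τ : Fin n → K → K := fun i x => funMap (autInvFunc i) ![x]
  fun
  | .addAssoc => ∀ x y z : K, (x + y) + z = x + (y + z)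
  | .zeroAdd => ∀ x : K, 0 + x = x
  | .negAddCancel => ∀ x : K, -x + x = 0
  | .mulAssoc => ∀ x y z : K, (x * y) * z = x * (y * z)
  | .mulComm => ∀ x y : K, x * y = y * x
  | .oneMul => ∀ x : K, 1 * x = x
  | .mulInvCancel => ∀ x : K, x ≠ 0 → x * x⁻¹ = 1
  | .invZero => (0 : K)⁻¹ = 0
  | .leftDistrib => ∀ x y z : K, x * (y + z) = x * y + x * z
  | .zeroNeOne => (0 : K) ≠ 1
  | .autAdd i => ∀ x y : K, σ i (x + y) = σ i x + σ i y
  | .autMul i => ∀ x y : K, σ i (x * y) = σ i x * σ i y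
  | .autAutInv i => ∀ x : K, σ i (τ i x) = x
  | .autInvAut i => ∀ x : K, τ i (σ i x) = x
  | .autComm i j => ∀ x : K, σ i (σ j x) = σ j (σ i x)

theorem Ax.realize_toSentence_iff (a : Ax n) : K ⊨ a.toSentence ↔ a.toProp K := by
  have e : (default : Fin 0 → K) = ![] := Subsingleton.elim _ _
  cases a <;>
    simp [Sentence.Realize, Formula.Realize, Ax.toSentence, Ax.toProp,
      Term.realize_constants, constantMap, e] <;> exact Iff.rfl

theorem Ax.toProp_of_model [(theory n).Model K] (a : Ax n) : a.toProp K :=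
  (a.realize_toSentence_iff K).1
    (Theory.realize_sentence_of_mem (theory n) (Set.mem_range_self a))

/-- A model of `T` is a field, with the operations given by the symbols of the language. -/
abbrev fieldOfModel [(theory n).Model K] : Field K :=
  letI := zeroOfStructure (n := n) K
  letI := oneOfStructure (n := n) K
  letI := mulOfStructure (n := n) K
  letI := addOfStructure (n := n) K
  letI := negOfStructure (n := n) K
  letI := invOfStructure (n := n) K
  Field.ofMinimalAxioms K
    ((Ax.addAssoc : Ax n).toProp_of_model K)
    ((Ax.zeroAdd : Ax n).toProp_of_model K)
    ((Ax.negAddCancel : Ax n).toProp_of_model K)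
    ((Ax.mulAssoc : Ax n).toProp_of_model K)
    ((Ax.mulComm : Ax n).toProp_of_model K)
    ((Ax.oneMul : Ax n).toProp_of_model K)
    ((Ax.mulInvCancel : Ax n).toProp_of_model K)
    ((Ax.invZero : Ax n).toProp_of_model K)
    ((Ax.leftDistrib : Ax n).toProp_of_model K)
    ⟨0, 1, (Ax.zeroNeOne : Ax n).toProp_of_model K⟩

end Ops

/-! ### Relatively algebraically closed models and the closure `acl_σ` -/

section Classes

variable {n : ℕ}

/-- A substructure `S` of a model `𝔅` of `T` (that is, a subfield closed under all `σᵢ` and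
`σᵢ⁻¹`) is relatively algebraically closed in `𝔅` if every root in `𝔅` of a nonzero polynomial in
one variable with coefficients in `S` lies in `S`. -/
def IsRelAlgClosedIn {B : Type u} [(lang n).Structure B] [(theory n).Model B]
    (S : (lang n).Substructure B) : Prop :=
  letI : Field B := fieldOfModel (n := n) B
  ∀ p : Polynomial B, p ≠ 0 → (∀ k, p.coeff k ∈ S) → ∀ b : B, p.eval b = 0 → b ∈ S

/-- `𝔄` is a relatively algebraically closed model of `T`: it is a model of `T`, and for every
extension `𝔅 ⊨ T` of `𝔄` (given by an embedding `𝔄 → 𝔅`) every root in `𝔅` of a nonzero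
polynomial with coefficients from `𝔄` lies in `𝔄`. -/
def IsRelAlgClosedModel (A : Type u) [(lang n).Structure A] : Prop :=
  (A ⊨ theory n) ∧
    ∀ (B : Type u) [(lang n).Structure B] [(theory n).Model B] (f : A ↪[lang n] B),
      IsRelAlgClosedIn f.toHom.range

/-- `acl_σ^𝔄(X)`: the smallest subfield of `𝔄` that contains `X`, is closed under the
distinguished automorphisms (and their inverses) and is relatively algebraically closed in `𝔄`. -/
def acl (A : Type u) [(lang n).Structure A] [(theory n).Model A] (X : Set A) :
    (lang n).Substructure A :=
  sInf {S | X ⊆ S ∧ IsRelAlgClosedIn S}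

theorem isLeast_acl (A : Type u) [(lang n).Structure A] [(theory n).Model A] (X : Set A) :
    IsLeast {S : (lang n).Substructure A | X ⊆ S ∧ IsRelAlgClosedIn S} (acl A X) := by
  refine ⟨⟨fun x hx => ?_, fun p hp hc b hb => ?_⟩, fun S hS => sInf_le hS⟩
  · exact Substructure.mem_sInf.2 fun S hS => hS.1 hx
  · exact Substructure.mem_sInf.2 fun S hS =>
      hS.2 p hp (fun k => Substructure.mem_sInf.1 (hc k) S hS) b hb

/-- The class `𝒦_{𝔄₀}`: its members are the relatively algebraically closed models of `T` that
contain (a copy of) `𝔄₀`, and `𝔄 ≼ 𝔅` means that `𝔄` and `𝔅` are members of the class and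
`𝔄 ⊆ 𝔅`. -/
def fcaClass (A₀ : Bundled.{u} (lang n).Structure) : AbstractClass.{u} (lang n) where
  carrier := {B | IsRelAlgClosedModel (n := n) B ∧ Nonempty (A₀ ↪[lang n] B)}
  Strong B S :=
    (IsRelAlgClosedModel (n := n) S ∧ Nonempty (A₀ ↪[lang n] S)) ∧
      (IsRelAlgClosedModel (n := n) B ∧ Nonempty (A₀ ↪[lang n] B))

end Classes

end FCA

/-! Everything rests on one amalgamation fact for fields with commuting automorphisms. If k is
perfect and relatively algebraically closed in B, then C ⊗ B over k is a domain for every extension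
field C. The given automorphisms act on this tensor product and hence on its fraction field, which
amalgamates B and C over k (`exists_amalgam`). Relatively algebraically closed models are perfect,
because Frobenius is an embedding of such a model into itself. This property and perfectness both
descend to a submodel relatively algebraically closed in the model: a root in any extension of the
submodel is carried into an amalgam with the larger model and caught there. Hence `acl` of the empty
set is itself a relatively algebraically closed model. Amalgams are brought into the class by
embedding an arbitrary model in a relatively algebraically closed one
(`exists_isRelAlgClosedModel`). Joint embedding is amalgamation over the copies of 𝔄₀ that members
contain. -/

/-! ### Tensor products over a perfect, relatively algebraically closed subfield -/

-- The coefficients of a monic factor over B are integral over k, hence lie in k, so any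
-- factorisation already takes place over k.
open Polynomial in
theorem Irreducible.map_of_isIntegrallyClosedIn {k B : Type*} [Field k] [Field B] [Algebra k B]
    [IsIntegrallyClosedIn k B] {f : k[X]} (hm : f.Monic) (hf : Irreducible f) :
    Irreducible (f.map (algebraMap k B)) := by
  have lift : ∀ g : B[X], g.Monic → g ∣ f.map (algebraMap k B) →
      ∃ g₀ : k[X], g₀.map (algebraMap k B) = g ∧ g₀.Monic := by
    intro g hg hd
    obtain ⟨g₁, h₁⟩ := integralClosure.mem_lifts_of_monic_of_dvd_map B hm hg hd
    have hl : g ∈ lifts (algebraMap k B) := by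
      rw [lifts_iff_coeff_lifts]
      intro i
      have hi : IsIntegral k (g.coeff i) := by
        rw [← h₁]
        rw [coe_mapRingHom, coeff_map]
        exact (g₁.coeff i).2
      exact (IsIntegrallyClosedIn.isIntegral_iff (R := k)).1 hi
    obtain ⟨g₀, h₀, -, hg₀⟩ := lifts_and_natDegree_eq_and_monic hl hg
    exact ⟨g₀, h₀, hg₀⟩
  have inj := map_injective (algebraMap k B) (algebraMap k B).injective
  refine (irreducible_of_monic (hm.map _) fun h => hf.ne_one (inj (by simpa using h))).2 ?_
  intro g h hg hh hgh
  obtain ⟨g₀, rfl, hg₀⟩ := lift g hg ⟨h, hgh.symm⟩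
  obtain ⟨h₀, rfl, hh₀⟩ := lift h hh ⟨_, (mul_comm _ _).trans hgh |>.symm⟩
  rw [← Polynomial.map_mul] at hgh
  have := (irreducible_of_monic hm hf.ne_one).1 hf g₀ h₀ hg₀ hh₀ (inj hgh)
  exact this.imp (fun h => by rw [h, Polynomial.map_one]) fun h => by rw [h, Polynomial.map_one]

-- Write L = k(α). The minimal polynomial of α stays irreducible over B, and adjoining a root of it
-- to B gives a field that maps onto B ⊗ L.
open scoped TensorProduct in
theorem isField_tensorProduct_of_finite_of_isSeparable {k B L : Type*} [Field k] [Field B] [Field L]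
    [Algebra k B] [Algebra k L] [IsIntegrallyClosedIn k B] [FiniteDimensional k L]
    [Algebra.IsSeparable k L] : IsField (B ⊗[k] L) := by
  obtain ⟨α, hα⟩ := Field.exists_primitive_element k L
  have hi : IsIntegral k α := Algebra.IsIntegral.isIntegral α
  have : Fact (Irreducible ((minpoly k α).map (algebraMap k B))) :=
    ⟨(minpoly.irreducible hi).map_of_isIntegrallyClosedIn (minpoly.monic hi)⟩
  let φ : AdjoinRoot ((minpoly k α).map (algebraMap k B)) →ₐ[B] B ⊗[k] L :=
    AdjoinRoot.liftAlgHom _ (Algebra.ofId B _) (1 ⊗ₜ α) (by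
      have h := congrArg (Algebra.TensorProduct.includeRight : L →ₐ[k] B ⊗[k] L)
        (minpoly.aeval k α)
      rw [← Polynomial.aeval_algHom_apply, map_zero] at h
      rw [Polynomial.eval₂_map, ← h, Polynomial.aeval_def]
      rfl)
  have hroot : φ (AdjoinRoot.root _) = 1 ⊗ₜ α := AdjoinRoot.liftAlgHom_root _ _ _ _
  have hα' : Algebra.adjoin k {α} = ⊤ := by
    rw [← IntermediateField.adjoin_simple_toSubalgebra_of_isAlgebraic hi.isAlgebraic, hα]
    rfl
  have hL : ∀ l : L, (1 : B) ⊗ₜ[k] l ∈ φ.range := by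
    intro l
    have hle : (⊤ : Subalgebra k L) ≤ (φ.range.restrictScalars k).comap
        (Algebra.TensorProduct.includeRight : L →ₐ[k] B ⊗[k] L) := by
      rw [← hα', Algebra.adjoin_le_iff, Set.singleton_subset_iff]
      exact ⟨_, hroot⟩
    exact hle (Algebra.mem_top (x := l))
  have hs : Function.Surjective φ := by
    intro x
    induction x with
    | zero => exact ⟨0, map_zero _⟩
    | add x y hx hy =>
      obtain ⟨a, rfl⟩ := hx
      obtain ⟨b, rfl⟩ := hy
      exact ⟨a + b, map_add _ _ _⟩
    | tmul b l =>
      obtain ⟨a, ha⟩ := hL l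
      refine ⟨b • a, ?_⟩
      rw [map_smul]
      change b • (φ a) = _
      rw [show φ a = 1 ⊗ₜ l from ha, TensorProduct.smul_tmul', smul_eq_mul, mul_one]
  exact (RingEquiv.ofBijective φ ⟨φ.toRingHom.injective, hs⟩).symm.toMulEquiv.isField
    (Field.toIsField _)

open scoped TensorProduct in
theorem Algebra.TensorProduct.basis_repr_map {k C D B ι : Type*} [Field k] [CommRing C] [CommRing D]
    [CommRing B] [Algebra k C] [Algebra k D] [Algebra k B] (b : Module.Basis ι k B) (f : C →ₐ[k] D)
    (x : C ⊗[k] B) (i : ι) :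
    (Algebra.TensorProduct.basis D b).repr (Algebra.TensorProduct.map f (AlgHom.id k B) x) i =
      f ((Algebra.TensorProduct.basis C b).repr x i) := by
  induction x with
  | zero => simp
  | add x y hx hy => simp [hx, hy]
  | tmul c y => simp [Algebra.TensorProduct.basis_repr_tmul]

-- Modulo a maximal ideal m of C the tensor product becomes a field, so x or y vanishes there.
-- Coordinates along a basis of B turn this into membership in m, and the maximal ideals of C
-- intersect in 0.
open scoped TensorProduct in
theorem noZeroDivisors_tensorProduct_of_finiteType {k B C : Type*} [Field k] [PerfectField k]
    [Field B] [CommRing C] [IsDomain C] [Algebra k B] [Algebra k C] [IsIntegrallyClosedIn k B]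
    [Algebra.FiniteType k C] : NoZeroDivisors (C ⊗[k] B) := by
  refine ⟨fun {x y} hxy => ?_⟩
  let b := Module.Basis.ofVectorSpace k B
  let bC := Algebra.TensorProduct.basis C b
  have key : ∀ i j, bC.repr x i * bC.repr y j = 0 := by
    intro i j
    have hJ : IsJacobsonRing C := isJacobsonRing_of_finiteType (A := k)
    have h0 : (⊥ : Ideal C).jacobson = ⊥ :=
      IsJacobsonRing.out hJ (Ideal.IsPrime.isRadical Ideal.isPrime_bot)
    rw [← Ideal.mem_bot, ← h0, Ideal.jacobson, Ideal.mem_sInf]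
    rintro m ⟨-, hm⟩
    let _ : Field (C ⧸ m) := Ideal.Quotient.field m
    -- Zariski's lemma; the residue field is then separable over k because k is perfect.
    have : FiniteDimensional k (C ⧸ m) := finite_of_finite_type_of_isJacobsonRing k (C ⧸ m)
    have hF : IsField (B ⊗[k] (C ⧸ m)) := isField_tensorProduct_of_finite_of_isSeparable
    let _ : Field (B ⊗[k] (C ⧸ m)) := hF.toField
    let π := Algebra.TensorProduct.map (Ideal.Quotient.mkₐ k m) (AlgHom.id k B)
    have h : Algebra.TensorProduct.comm k (C ⧸ m) B (π x) *
        Algebra.TensorProduct.comm k (C ⧸ m) B (π y) = 0 := by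
      rw [← map_mul, ← map_mul, hxy, map_zero, map_zero]
    have aux : ∀ z i, Algebra.TensorProduct.comm k (C ⧸ m) B (π z) = 0 → bC.repr z i ∈ m := by
      intro z i hz
      rw [EmbeddingLike.map_eq_zero_iff] at hz
      have := Algebra.TensorProduct.basis_repr_map b (Ideal.Quotient.mkₐ k m) z i
      change (Algebra.TensorProduct.basis (C ⧸ m) b).repr (π z) i = _ at this
      rw [hz, map_zero, Finsupp.zero_apply] at this
      exact Ideal.Quotient.eq_zero_iff_mem.1 this.symm
    rcases mul_eq_zero.1 h with h | h
    · exact m.mul_mem_right _ (aux x i h)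
    · exact m.mul_mem_left _ (aux y j h)
  by_contra! hne
  obtain ⟨i, hi⟩ := Finsupp.ne_iff.1 ((map_ne_zero_iff _ bC.repr.injective).2 hne.1)
  obtain ⟨j, hj⟩ := Finsupp.ne_iff.1 ((map_ne_zero_iff _ bC.repr.injective).2 hne.2)
  exact (mul_ne_zero hi hj) (key i j)

-- Two elements involve only finitely many elements of C, and flatness embeds the tensor product of
-- the subalgebra these generate.
open scoped TensorProduct in
theorem isDomain_tensorProduct_of_isIntegrallyClosedIn {k B C : Type*} [Field k] [PerfectField k]
    [Field B] [CommRing C] [IsDomain C] [Algebra k B] [Algebra k C] [IsIntegrallyClosedIn k B] :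
    IsDomain (C ⊗[k] B) := by
  have : NoZeroDivisors (C ⊗[k] B) := by
    refine ⟨fun {x y} hxy => ?_⟩
    obtain ⟨D, hD, x', rfl⟩ := TensorProduct.Algebra.exists_of_fg x
    obtain ⟨E, hE, y', rfl⟩ := TensorProduct.Algebra.exists_of_fg y
    let F := D ⊔ E
    have : Algebra.FiniteType k F := F.fg_iff_finiteType.1 (hD.sup hE)
    have := noZeroDivisors_tensorProduct_of_finiteType (k := k) (B := B) (C := F)
    let φ : F ⊗[k] B →ₐ[k] C ⊗[k] B := Algebra.TensorProduct.map F.val (AlgHom.id k B)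
    have hφ : Function.Injective φ :=
      Module.Flat.rTensor_preserves_injective_linearMap F.val.toLinearMap Subtype.val_injective
    have lift : ∀ (G : Subalgebra k C) (hG : G ≤ F) (z : G ⊗[k] B),
        G.val.toLinearMap.rTensor B z =
          φ (Algebra.TensorProduct.map (Subalgebra.inclusion hG) (AlgHom.id k B) z) := by
      intro G hG z
      induction z with
      | zero => simp
      | add x y hx hy => simp only [map_add, hx, hy]
      | tmul c y => simp [φ]
    rw [lift D le_sup_left, lift E le_sup_right] at hxy ⊢
    rw [← map_mul, map_eq_zero_iff _ hφ] at hxy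
    rw [map_eq_zero_iff _ hφ, map_eq_zero_iff _ hφ]
    exact mul_eq_zero.1 hxy
  exact NoZeroDivisors.to_isDomain _

/-! ### Amalgamating fields with commuting automorphisms -/

section DifferenceFields

open scoped TensorProduct

theorem Algebra.TensorProduct.exists_ringHom_tmul {k B C S : Type*} [CommRing k] [CommRing B]
    [CommRing C] [CommRing S] [Algebra k B] [Algebra k C] (f : C →+* S) (g : B →+* S)
    (h : ∀ a, f (algebraMap k C a) = g (algebraMap k B a)) :
    ∃ e : C ⊗[k] B →+* S, ∀ c b, e (c ⊗ₜ b) = f c * g b := by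
  let _ : Algebra k S := (f.comp (algebraMap k C)).toAlgebra
  let f' : C →ₐ[k] S := ⟨f, fun _ => rfl⟩
  let g' : B →ₐ[k] S := ⟨g, fun a => (h a).symm⟩
  exact ⟨(Algebra.TensorProduct.lift f' g' fun _ _ => Commute.all _ _).toRingHom, fun c b =>
    Algebra.TensorProduct.lift_tmul _ _ _ c b⟩

/-- β and γ are only σ-semilinear, but as ring maps into the tensor product they agree on k, so they
glue; the inverses glue likewise. -/
theorem Algebra.TensorProduct.exists_ringEquiv_tmul {k B C : Type*} [CommRing k] [CommRing B]
    [CommRing C] [Algebra k B] [Algebra k C] (σ : k ≃+* k) (β : B ≃+* B) (γ : C ≃+* C)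
    (hβ : ∀ a, β (algebraMap k B a) = algebraMap k B (σ a))
    (hγ : ∀ a, γ (algebraMap k C a) = algebraMap k C (σ a)) :
    ∃ e : C ⊗[k] B ≃+* C ⊗[k] B, ∀ c b, e (c ⊗ₜ b) = γ c ⊗ₜ β b := by
  have key : ∀ (σ : k → k) (β : B →+* B) (γ : C →+* C)
      (_ : ∀ a, β (algebraMap k B a) = algebraMap k B (σ a))
      (_ : ∀ a, γ (algebraMap k C a) = algebraMap k C (σ a)),
      ∃ e : C ⊗[k] B →+* C ⊗[k] B, ∀ c b, e (c ⊗ₜ b) = γ c ⊗ₜ β b := by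
    intro σ β γ hβ hγ
    obtain ⟨e, he⟩ := Algebra.TensorProduct.exists_ringHom_tmul (k := k)
      (Algebra.TensorProduct.includeLeftRingHom.comp γ)
      ((Algebra.TensorProduct.includeRight : B →ₐ[k] C ⊗[k] B).toRingHom.comp β)
      (fun a => by simp [hβ, hγ, ← Algebra.TensorProduct.algebraMap_apply])
    exact ⟨e, fun c b => by simp [he]⟩
  obtain ⟨e, he⟩ := key σ β γ hβ hγ
  obtain ⟨e', he'⟩ := key σ.symm β.symm γ.symm
    (fun a => by rw [RingHom.coe_coe, RingEquiv.symm_apply_eq, hβ, RingEquiv.apply_symm_apply])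
    (fun a => by rw [RingHom.coe_coe, RingEquiv.symm_apply_eq, hγ, RingEquiv.apply_symm_apply])
  refine ⟨RingEquiv.ofRingHom e e' ?_ ?_, he⟩
  all_goals
    refine RingHom.ext fun x => ?_
    induction x with
    | zero => simp
    | add x y hx hy => simp only [map_add, hx, hy]
    | tmul c b => simp [he, he']

theorem exists_fractionRing_amalgam {ι : Type*} {k B C : Type u} [Field k] [Field B] [Field C]
    [Algebra k B] [Algebra k C] [PerfectField k] [IsIntegrallyClosedIn k B]
    (σ : ι → k ≃+* k) (β : ι → B ≃+* B) (γ : ι → C ≃+* C)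
    (hβ : ∀ i a, β i (algebraMap k B a) = algebraMap k B (σ i a))
    (hγ : ∀ i a, γ i (algebraMap k C a) = algebraMap k C (σ i a))
    (cβ : ∀ i j b, β i (β j b) = β j (β i b)) (cγ : ∀ i j c, γ i (γ j c) = γ j (γ i c)) :
    ∃ (D : Type u) (_ : Field D) (δ : ι → D ≃+* D) (f : B →+* D) (g : C →+* D),
      (∀ i j d, δ i (δ j d) = δ j (δ i d)) ∧ (∀ i b, f (β i b) = δ i (f b)) ∧
      (∀ i c, g (γ i c) = δ i (g c)) ∧ ∀ a, f (algebraMap k B a) = g (algebraMap k C a) := by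
  have : IsDomain (C ⊗[k] B) := isDomain_tensorProduct_of_isIntegrallyClosedIn
  choose e he using fun i => Algebra.TensorProduct.exists_ringEquiv_tmul (σ i) (β i) (γ i)
    (hβ i) (hγ i)
  let D := FractionRing (C ⊗[k] B)
  let δ : ι → D ≃+* D := fun i => IsFractionRing.ringEquivOfRingEquiv (e i)
  have hδ : ∀ i x, δ i (algebraMap (C ⊗[k] B) D x) = algebraMap (C ⊗[k] B) D (e i x) :=
    fun i x => IsFractionRing.ringEquivOfRingEquiv_algebraMap _ _
  have ce : ∀ i j x, e i (e j x) = e j (e i x) := by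
    intro i j x
    induction x with
    | zero => simp
    | add x y hx hy => simp only [map_add, hx, hy]
    | tmul c b => rw [he, he, he, he, cβ, cγ]
  refine ⟨D, inferInstance, δ,
    (algebraMap (C ⊗[k] B) D).comp
      (Algebra.TensorProduct.includeRight : B →ₐ[k] C ⊗[k] B).toRingHom,
    (algebraMap (C ⊗[k] B) D).comp Algebra.TensorProduct.includeLeftRingHom, ?_, ?_, ?_, ?_⟩
  · intro i j d
    have h : ((δ i).toRingHom.comp (δ j).toRingHom) = (δ j).toRingHom.comp (δ i).toRingHom := by
      apply IsLocalization.ringHom_ext (nonZeroDivisors (C ⊗[k] B))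
      refine RingHom.ext fun x => ?_
      simp [hδ, ce i j]
    exact congrArg (fun φ : D →+* D => φ d) h
  · intro i b
    simp [hδ, he]
  · intro i b
    simp [hδ, he]
  · intro a
    simp [Algebra.TensorProduct.algebraMap_apply]

/-! ### Maximal algebraic extensions inside a power of an algebraic closure -/

theorem IsAlgebraic.of_semilinear {k B : Type*} [Field k] [Field B] [Algebra k B] (σ : k ≃+* k)
    (β : B →+* B) (h : ∀ a, β (algebraMap k B a) = algebraMap k B (σ a)) {b : B}
    (hb : IsAlgebraic k b) : IsAlgebraic k (β b) := by
  obtain ⟨p, hp, hpb⟩ := hb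
  refine ⟨p.map σ.toRingHom, (Polynomial.map_ne_zero_iff σ.injective).2 hp, ?_⟩
  have := congrArg β hpb
  rw [map_zero, Polynomial.aeval_def, Polynomial.hom_eval₂] at this
  rw [Polynomial.aeval_def, Polynomial.eval₂_map, ← this]
  congr 1
  ext a
  exact (h a).symm

/-- The coordinate shift on functions on a group, `x ↦ (v ↦ x (v * w))`. -/
def shiftHom {W : Type*} [Group W] (Ω : Type*) [Semiring Ω] (w : W) : (W → Ω) →+* (W → Ω) :=
  RingHom.pi fun v => Pi.evalRingHom (fun _ => Ω) (v * w)

@[simp]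
theorem shiftHom_apply {W Ω : Type*} [Group W] [Semiring Ω] (w v : W) (x : W → Ω) :
    shiftHom Ω w x v = x (v * w) := rfl

/-- A subring of a power `W → Ω` of a field, `W` the free group on `ι`, which is a field and on
which the coordinate shifts restrict to commuting automorphisms. -/
structure IsDifferenceSubfield {ι Ω : Type*} [Field Ω] (R : Subring (FreeGroup ι → Ω)) : Prop where
  exists_inv : ∀ x ∈ R, x ≠ 0 → ∃ y ∈ R, x * y = 1
  shift_mem : ∀ i, ∀ x ∈ R, shiftHom Ω (FreeGroup.of i) x ∈ R
  shift_inv_mem : ∀ i, ∀ x ∈ R, shiftHom Ω (FreeGroup.of i)⁻¹ x ∈ R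
  shift_comm : ∀ i j, ∀ x ∈ R, shiftHom Ω (FreeGroup.of i) (shiftHom Ω (FreeGroup.of j) x) =
    shiftHom Ω (FreeGroup.of j) (shiftHom Ω (FreeGroup.of i) x)

/-- The orbit map of a field with automorphisms `σ i`, read off through a homomorphism to `Ω`. -/
def orbitHom {ι E Ω : Type*} [Field E] [Field Ω] (σ : ι → E ≃+* E) (φ : E →+* Ω) :
    E →+* (FreeGroup ι → Ω) :=
  RingHom.pi fun w => φ.comp (FreeGroup.lift (β := RingAut E) σ w).toRingHom

theorem orbitHom_apply {ι E Ω : Type*} [Field E] [Field Ω] (σ : ι → E ≃+* E) (φ : E →+* Ω)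
    (e : E) (w : FreeGroup ι) :
    orbitHom σ φ e w = φ (FreeGroup.lift (β := RingAut E) σ w e) := rfl

theorem shiftHom_orbitHom {ι E Ω : Type*} [Field E] [Field Ω] (σ : ι → E ≃+* E) (φ : E →+* Ω)
    (i : ι) (e : E) : shiftHom Ω (FreeGroup.of i) (orbitHom σ φ e) = orbitHom σ φ (σ i e) := by
  ext w
  simp [orbitHom_apply]

theorem shiftHom_inv_orbitHom {ι E Ω : Type*} [Field E] [Field Ω] (σ : ι → E ≃+* E) (φ : E →+* Ω)
    (i : ι) (e : E) :
    shiftHom Ω (FreeGroup.of i)⁻¹ (orbitHom σ φ e) = orbitHom σ φ ((σ i).symm e) := by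
  ext w
  simp only [shiftHom_apply, orbitHom_apply, map_mul, map_inv, FreeGroup.lift_apply_of]
  rfl

theorem isDifferenceSubfield_range_orbitHom {ι E Ω : Type*} [Field E] [Field Ω]
    (σ : ι → E ≃+* E) (hσ : ∀ i j e, σ i (σ j e) = σ j (σ i e)) (φ : E →+* Ω) :
    IsDifferenceSubfield (orbitHom σ φ).range where
  exists_inv := by
    rintro _ ⟨e, rfl⟩ he
    have : e ≠ 0 := by
      rintro rfl
      exact he (map_zero _)
    exact ⟨_, ⟨e⁻¹, rfl⟩, by rw [← map_mul, mul_inv_cancel₀ this, map_one]⟩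
  shift_mem := by
    rintro i _ ⟨e, rfl⟩
    exact ⟨_, (shiftHom_orbitHom σ φ i e).symm⟩
  shift_inv_mem := by
    rintro i _ ⟨e, rfl⟩
    exact ⟨_, (shiftHom_inv_orbitHom σ φ i e).symm⟩
  shift_comm := by
    rintro i j _ ⟨e, rfl⟩
    simp only [shiftHom_orbitHom, hσ i j]

theorem IsDifferenceSubfield.exists_maximal {ι Ω : Type*} [Field Ω]
    {R : Subring (FreeGroup ι → Ω)} (hR : IsDifferenceSubfield R) :
    ∃ M, R ≤ M ∧ Maximal IsDifferenceSubfield M := by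
  refine zorn_le_nonempty₀ {R | IsDifferenceSubfield R} (fun c hc hchain y hy => ?_) R hR
  have hmem : ∀ {x}, x ∈ sSup c ↔ ∃ S ∈ c, x ∈ S :=
    Subring.mem_sSup_of_directedOn ⟨y, hy⟩ hchain.directedOn
  refine ⟨sSup c, ⟨?_, ?_, ?_, ?_⟩, fun z hz => le_sSup hz⟩
  · intro x hx h0
    obtain ⟨S, hS, hx⟩ := hmem.1 hx
    obtain ⟨z, hz, h⟩ := (hc hS).exists_inv x hx h0
    exact ⟨z, hmem.2 ⟨S, hS, hz⟩, h⟩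
  · intro i x hx
    obtain ⟨S, hS, hx⟩ := hmem.1 hx
    exact hmem.2 ⟨S, hS, (hc hS).shift_mem i x hx⟩
  · intro i x hx
    obtain ⟨S, hS, hx⟩ := hmem.1 hx
    exact hmem.2 ⟨S, hS, (hc hS).shift_inv_mem i x hx⟩
  · intro i j x hx
    obtain ⟨S, hS, hx⟩ := hmem.1 hx
    exact (hc hS).shift_comm i j x hx

theorem IsDifferenceSubfield.isField {ι Ω : Type*} [Field Ω]
    {R : Subring (FreeGroup ι → Ω)} (hR : IsDifferenceSubfield R) : IsField R where
  exists_pair_ne := exists_pair_ne R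
  mul_comm := mul_comm
  mul_inv_cancel {a} ha := by
    obtain ⟨y, hy, h⟩ := hR.exists_inv a a.2 (by simpa using ha)
    exact ⟨⟨y, hy⟩, Subtype.ext h⟩

/-- The automorphism of a difference subfield given by the shift. -/
def IsDifferenceSubfield.shiftEquiv {ι Ω : Type*} [Field Ω] {R : Subring (FreeGroup ι → Ω)}
    (hR : IsDifferenceSubfield R) (i : ι) : R ≃+* R :=
  RingEquiv.ofRingHom
    ((shiftHom Ω (FreeGroup.of i)).restrict R R (hR.shift_mem i))
    ((shiftHom Ω (FreeGroup.of i)⁻¹).restrict R R (hR.shift_inv_mem i))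
    (by ext; simp) (by ext; simp)

/-- At v = 1 this recovers every coordinate of x from its orbit: the inclusion of R is the orbit map
of evaluation at 1. -/
theorem IsDifferenceSubfield.lift_shiftEquiv_apply {ι Ω : Type*} [Field Ω]
    {R : Subring (FreeGroup ι → Ω)} (hR : IsDifferenceSubfield R) (w v : FreeGroup ι) (x : R) :
    (FreeGroup.lift (β := RingAut R) hR.shiftEquiv w x).1 v = x.1 (v * w) := by
  induction w generalizing v x with
  | C1 => simp
  | of i => simp [shiftEquiv]
  | inv_of i ih =>
    rw [map_inv, FreeGroup.lift_apply_of]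
    rfl
  | mul w w' h h' =>
    rw [map_mul, RingAut.mul_apply, h, h', mul_assoc]

theorem FreeGroup.lift_ringAut_semilinear {ι M N : Type*} [Semiring M] [Semiring N]
    (τ : ι → M ≃+* M) (ρ : ι → N ≃+* N) (f : M →+* N) (hf : ∀ i x, f (τ i x) = ρ i (f x))
    (w : FreeGroup ι) (x : M) :
    f (FreeGroup.lift (β := RingAut M) τ w x) = FreeGroup.lift (β := RingAut N) ρ w (f x) := by
  induction w generalizing x with
  | C1 => simp
  | of i => simp [hf]
  | inv_of i ih =>
    rw [_root_.map_inv, _root_.map_inv, FreeGroup.lift_apply_of, FreeGroup.lift_apply_of]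
    change f ((τ i).symm x) = (ρ i).symm (f x)
    rw [RingEquiv.eq_symm_apply, ← hf, RingEquiv.apply_symm_apply]
  | mul w w' h h' => simp [h, h']

theorem nonempty_algHom_algebraicClosure (R N Ω : Type*) [Field R] [Field N] [Field Ω]
    [IsAlgClosed Ω] [Algebra R N] [Algebra R Ω] : Nonempty (algebraicClosure R N →ₐ[R] Ω) :=
  ⟨IsAlgClosed.lift⟩

/-- Every field with commuting automorphisms extends to one that has no proper algebraic
extension as a field with commuting automorphisms. -/
theorem exists_maximal_algebraic_extension {ι : Type} {D : Type u} [Field D] (δ : ι → D ≃+* D)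
    (hδ : ∀ i j d, δ i (δ j d) = δ j (δ i d)) :
    ∃ (M : Type u) (_ : Field M) (τ : ι → M ≃+* M) (g : D →+* M),
      (∀ i j x, τ i (τ j x) = τ j (τ i x)) ∧ (∀ i d, g (δ i d) = τ i (g d)) ∧
      ∀ (N : Type u) (_ : Field N) (ρ : ι → N ≃+* N) (f : M →+* N),
        (∀ i j x, ρ i (ρ j x) = ρ j (ρ i x)) → (∀ i x, f (τ i x) = ρ i (f x)) →
        ∀ p : Polynomial M, p ≠ 0 → ∀ b, p.eval₂ f b = 0 → ∃ a, f a = b := by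
  -- The orbit map places D in the fixed set of functions from the free group to Ω, so Zorn's lemma
  -- applies without size problems. Free words act without using commutation, which is instead
  -- required on the members.
  let Ω := AlgebraicClosure D
  let φ₀ : D →+* Ω := algebraMap D Ω
  obtain ⟨R, hDR, hR⟩ := (isDifferenceSubfield_range_orbitHom δ hδ φ₀).exists_maximal
  let _ : Field R := hR.prop.isField.toField
  refine ⟨R, inferInstance, hR.prop.shiftEquiv,
    (orbitHom δ φ₀).codRestrict R fun x => hDR ⟨x, rfl⟩, ?_, ?_, ?_⟩
  · intro i j x
    exact Subtype.ext (hR.prop.shift_comm i j x x.2)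
  · intro i d
    exact Subtype.ext (shiftHom_orbitHom δ φ₀ i d).symm
  · intro N _ ρ f hρ hf p hp b hb
    let _ : Algebra R N := f.toAlgebra
    -- Ω becomes an R-algebra through the coordinate at 1, so the part of N algebraic over R maps to
    -- Ω compatibly with that coordinate.
    let ev : R →+* Ω := (Pi.evalRingHom (fun _ => Ω) 1).comp R.subtype
    let _ : Algebra R Ω := ev.toAlgebra
    let E := algebraicClosure R N
    obtain ⟨φ⟩ := nonempty_algHom_algebraicClosure R N Ω
    have hsemi : ∀ i a, ρ i (algebraMap R N a) = algebraMap R N (hR.prop.shiftEquiv i a) :=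
      fun i a => (hf i a).symm
    have hE : ∀ i, ∀ x ∈ E, ρ i x ∈ E := fun i x hx =>
      IsAlgebraic.isIntegral ((IsIntegral.isAlgebraic hx).of_semilinear (hR.prop.shiftEquiv i)
        (ρ i).toRingHom (hsemi i))
    have hE' : ∀ i, ∀ x ∈ E, (ρ i).symm x ∈ E := fun i x hx =>
      IsAlgebraic.isIntegral ((IsIntegral.isAlgebraic hx).of_semilinear (hR.prop.shiftEquiv i).symm
        (ρ i).symm.toRingHom fun a => (RingEquiv.symm_apply_eq _).2 (by simp [hsemi]))
    let ε : ι → E ≃+* E := fun i => RingEquiv.ofRingHom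
      ((ρ i).toRingHom.restrict E E (hE i)) ((ρ i).symm.toRingHom.restrict E E (hE' i))
      (by ext; simp) (by ext; simp)
    have hε : ∀ i j e, ε i (ε j e) = ε j (ε i e) := fun i j e => Subtype.ext (hρ i j e)
    have hψ : ∀ x : R, orbitHom ε φ.toRingHom (algebraMap R E x) = x.1 := by
      intro x
      ext w
      rw [orbitHom_apply, ← FreeGroup.lift_ringAut_semilinear hR.prop.shiftEquiv ε (algebraMap R E)
        fun i x => Subtype.ext (hf i x)]
      refine (φ.commutes _).trans ?_
      change (FreeGroup.lift (β := RingAut R) hR.prop.shiftEquiv w x).1 1 = _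
      rw [hR.prop.lift_shiftEquiv_apply, one_mul]
    -- The orbit image of E is a difference subfield containing R, so maximality forces it back into
    -- R.
    have hle : (orbitHom ε φ.toRingHom).range ≤ R :=
      hR.2 (isDifferenceSubfield_range_orbitHom ε hε _) fun x hx => ⟨_, hψ ⟨x, hx⟩⟩
    have hbE : b ∈ E := IsAlgebraic.isIntegral ⟨p, hp, hb⟩
    let x : R := ⟨_, hle ⟨⟨b, hbE⟩, rfl⟩⟩
    have hx := (orbitHom ε φ.toRingHom).injective (hψ x)
    exact ⟨x, congrArg Subtype.val hx⟩

end DifferenceFields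

namespace FCA

open FirstOrder FirstOrder.Language FirstOrder.Language.Structure CategoryTheory

/-! ### Models of the theory as fields with automorphisms -/

section Bridge

variable {n : ℕ}

/-- Universal axioms pass to substructures; this is what makes `acl` a model. -/
theorem Ax.isUniversal_toSentence (a : Ax n) : a.toSentence.IsUniversal := by
  cases a <;> simp only [Ax.toSentence] <;> repeat apply BoundedFormula.IsUniversal.all
  all_goals first
    | exact (BoundedFormula.IsAtomic.equal _ _).isUniversal
    | exact (BoundedFormula.IsAtomic.equal _ _).isQF.not.isUniversal
    | exact ((BoundedFormula.IsAtomic.equal _ _).isQF.not.imp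
        (BoundedFormula.IsAtomic.equal _ _).isQF).isUniversal

instance : (theory n).IsUniversal :=
  ⟨by rintro _ ⟨a, rfl⟩; exact a.isUniversal_toSentence⟩

/-- The underlying field of a model of the theory of fields with commuting automorphisms. -/
def FieldOf (_n : ℕ) (K : Type u) : Type u := K

instance (K : Type u) [(lang n).Structure K] [(theory n).Model K] : Field (FieldOf n K) :=
  fieldOfModel (n := n) K

/-- The automorphism `σᵢ` of a model. -/
def autEquiv (K : Type u) [(lang n).Structure K] [(theory n).Model K] (i : Fin n) :
    FieldOf n K ≃+* FieldOf n K where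
  toFun x := funMap (M := K) (autFunc i) ![x]
  invFun x := funMap (M := K) (autInvFunc i) ![x]
  left_inv := (Ax.autInvAut i).toProp_of_model K
  right_inv := (Ax.autAutInv i).toProp_of_model K
  map_mul' := (Ax.autMul i).toProp_of_model K
  map_add' := (Ax.autAdd i).toProp_of_model K

theorem autEquiv_comm (K : Type u) [(lang n).Structure K] [(theory n).Model K] (i j : Fin n)
    (x : FieldOf n K) :
    autEquiv K i (autEquiv K j x) = autEquiv K j (autEquiv K i x) :=
  (Ax.autComm i j).toProp_of_model K x

theorem map_funMap₀ {A B : Type u} [(lang n).Structure A] [(lang n).Structure B]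
    (f : A ↪[lang n] B) (s : (lang n).Functions 0) : f (funMap s ![]) = funMap s ![] := by
  rw [f.map_fun]
  exact congrArg _ (Subsingleton.elim _ _)

theorem map_funMap₁ {A B : Type u} [(lang n).Structure A] [(lang n).Structure B]
    (f : A ↪[lang n] B) (s : (lang n).Functions 1) (x : A) :
    f (funMap s ![x]) = funMap s ![f x] := by
  rw [f.map_fun]
  exact congrArg _ (funext fun i => by fin_cases i; rfl)

theorem map_funMap₂ {A B : Type u} [(lang n).Structure A] [(lang n).Structure B]
    (f : A ↪[lang n] B) (s : (lang n).Functions 2) (x y : A) :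
    f (funMap s ![x, y]) = funMap s ![f x, f y] := by
  rw [f.map_fun]
  exact congrArg _ (funext fun i => by fin_cases i <;> rfl)

section Maps

variable {A B : Type u} [(lang n).Structure A] [(theory n).Model A] [(lang n).Structure B]
  [(theory n).Model B]

/-- The field homomorphism given by an embedding of models. -/
def ringHomOf (f : A ↪[lang n] B) : FieldOf n A →+* FieldOf n B where
  toFun := f
  map_zero' := map_funMap₀ f (zeroFunc n)
  map_one' := map_funMap₀ f (oneFunc n)
  map_add' := map_funMap₂ f (addFunc n)
  map_mul' := map_funMap₂ f (mulFunc n)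

theorem ringHomOf_autEquiv (f : A ↪[lang n] B) (i : Fin n) (x : FieldOf n A) :
    ringHomOf f (autEquiv A i x) = autEquiv B i (ringHomOf f x) :=
  map_funMap₁ f (autFunc i) x

/-- Only the σᵢ need a hypothesis: compatibility with field inversion and with the σᵢ⁻¹ is
automatic. -/
theorem exists_embedding_of_ringHom (g : FieldOf n A →+* FieldOf n B)
    (hg : ∀ i x, g (autEquiv A i x) = autEquiv B i (g x)) :
    ∃ f : A ↪[lang n] B, ∀ x : A, f x = g x := by
  have h₀ : ∀ s : (lang n).Functions 0, g (funMap (M := A) s ![]) = funMap (M := B) s ![] →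
      ∀ x : Fin 0 → A, g (funMap (M := A) s x) = funMap (M := B) s (g ∘ x) := by
    intro s h x
    obtain rfl : x = ![] := Subsingleton.elim _ _
    exact h.trans (congrArg _ (Subsingleton.elim _ _))
  have h₁ : ∀ s : (lang n).Functions 1,
      (∀ a : A, g (funMap (M := A) s ![a]) = funMap (M := B) s ![g a]) →
      ∀ x : Fin 1 → A, g (funMap (M := A) s x) = funMap (M := B) s (g ∘ x) := by
    intro s h x
    rw [show x = ![x 0] from funext fun i => by fin_cases i; rfl]
    exact (h _).trans (congrArg _ (funext fun i => by fin_cases i; rfl))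
  have h₂ : ∀ s : (lang n).Functions 2,
      (∀ a b : A, g (funMap (M := A) s ![a, b]) = funMap (M := B) s ![g a, g b]) →
      ∀ x : Fin 2 → A, g (funMap (M := A) s x) = funMap (M := B) s (g ∘ x) := by
    intro s h x
    rw [show x = ![x 0, x 1] from funext fun i => by fin_cases i <;> rfl]
    exact (h _ _).trans (congrArg _ (funext fun i => by fin_cases i <;> rfl))
  have h_symm : ∀ i x, g ((autEquiv A i).symm x) = (autEquiv B i).symm (g x) := fun i x => by
    rw [RingEquiv.eq_symm_apply, ← hg, RingEquiv.apply_symm_apply]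
  refine ⟨⟨⟨g, g.injective⟩, fun {m} s x => ?_, fun r => r.elim⟩, fun _ => rfl⟩
  cases s with
  | zero => exact h₀ (zeroFunc n) g.map_zero x
  | one => exact h₀ (oneFunc n) g.map_one x
  | mul => exact h₂ (mulFunc n) g.map_mul x
  | add => exact h₂ (addFunc n) g.map_add x
  | neg => exact h₁ (negFunc n) g.map_neg x
  | inv => exact h₁ (invFunc n) (map_inv₀ g) x
  | aut i => exact h₁ (autFunc i) (hg i) x
  | autInv i => exact h₁ (autInvFunc i) (h_symm i) x

/-- A model is relatively algebraically closed in an extension if and only if it contains the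
roots of its polynomials. -/
theorem isRelAlgClosedIn_range_iff (f : A ↪[lang n] B) :
    IsRelAlgClosedIn f.toHom.range ↔
      ∀ p : Polynomial (FieldOf n A), p ≠ 0 → ∀ b : FieldOf n B, p.eval₂ (ringHomOf f) b = 0 →
        ∃ a, ringHomOf f a = b := by
  have key : IsRelAlgClosedIn f.toHom.range ↔
      ∀ p : Polynomial (FieldOf n B), p ≠ 0 → (∀ k, ∃ a, ringHomOf f a = p.coeff k) →
        ∀ b, p.eval b = 0 → ∃ a, ringHomOf f a = b := Iff.rfl
  rw [key]
  constructor
  · intro h p hp b hb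
    refine h (p.map (ringHomOf f)) ((Polynomial.map_ne_zero_iff (ringHomOf f).injective).2 hp)
      (fun k => ⟨p.coeff k, (Polynomial.coeff_map (ringHomOf f) k).symm⟩) b ?_
    rw [Polynomial.eval_map, hb]
  · intro h p hp hc b hb
    obtain ⟨q, hq⟩ : p ∈ Polynomial.lifts (ringHomOf f) := by
      rw [Polynomial.lifts_iff_coeff_lifts]
      exact hc
    rw [Polynomial.coe_mapRingHom] at hq
    refine h q ?_ b ?_
    · rintro rfl
      exact hp (hq.symm.trans (Polynomial.map_zero _))
    · rw [← Polynomial.eval_map, hq, hb]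

end Maps

/-- The structure given by a field with automorphisms. -/
abbrev structureOfField {K : Type u} [Field K] (σ : Fin n → K ≃+* K) : (lang n).Structure K where
  funMap s x :=
    match s, x with
    | .zero, _ => 0
    | .one, _ => 1
    | .mul, x => x 0 * x 1
    | .add, x => x 0 + x 1
    | .neg, x => -x 0
    | .inv, x => (x 0)⁻¹
    | .aut i, x => σ i (x 0)
    | .autInv i, x => (σ i).symm (x 0)
  RelMap r := r.elim

theorem exists_model_of_field {K : Type u} [Field K] (σ : Fin n → K ≃+* K)
    (hσ : ∀ i j x, σ i (σ j x) = σ j (σ i x)) :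
    ∃ (M : Type u) (_ : (lang n).Structure M) (_ : (theory n).Model M) (e : K ≃+* FieldOf n M),
      ∀ i x, e (σ i x) = autEquiv M i (e x) := by
  let _ : (lang n).Structure K := structureOfField σ
  have hM : (theory n).Model K := by
    refine ⟨?_⟩
    rintro _ ⟨a, rfl⟩
    refine (a.realize_toSentence_iff K).2 ?_
    cases a with
    | addAssoc => exact add_assoc (G := K)
    | zeroAdd => exact zero_add (M := K)
    | negAddCancel => exact neg_add_cancel (G := K)
    | mulAssoc => exact mul_assoc (G := K)
    | mulComm => exact mul_comm (G := K)
    | oneMul => exact one_mul (M := K)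
    | mulInvCancel => exact fun x hx => mul_inv_cancel₀ (G₀ := K) hx
    | invZero => exact inv_zero (G₀ := K)
    | leftDistrib => exact mul_add (R := K)
    | zeroNeOne => exact zero_ne_one (α := K)
    | autAdd i => exact (σ i).map_add
    | autMul i => exact (σ i).map_mul
    | autAutInv i => exact (σ i).apply_symm_apply
    | autInvAut i => exact (σ i).symm_apply_apply
    | autComm i j => exact hσ i j
  exact ⟨K, inferInstance, hM, ⟨Equiv.refl K, fun _ _ => rfl, fun _ _ => rfl⟩, fun _ _ => rfl⟩

end Bridge

/-! ### Perfectness, amalgams and the class of relatively algebraically closed models -/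

section Amalgamation

variable {n : ℕ}

/-- Frobenius commutes with all automorphisms, so it presents A as an extension of itself, in which
every b is algebraic over the image. -/
theorem IsRelAlgClosedModel.perfectField {A : Type u} [(lang n).Structure A] [(theory n).Model A]
    (hA : IsRelAlgClosedModel (n := n) A) : PerfectField (FieldOf n A) := by
  obtain ⟨p, hp⟩ := ExpChar.exists (FieldOf n A)
  obtain ⟨f, hf⟩ := exists_embedding_of_ringHom (frobenius (FieldOf n A) p)
    fun i x => ((autEquiv A i).toRingHom.map_frobenius p x).symm
  have hfe : ringHomOf f = frobenius (FieldOf n A) p := RingHom.ext hf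
  have h := (isRelAlgClosedIn_range_iff f).1 (hA.2 A f)
  rw [hfe] at h
  have hp0 : 0 < p := expChar_pos (FieldOf n A) p
  have : PerfectRing (FieldOf n A) p := PerfectRing.ofSurjective _ p fun b =>
    -- The coefficient b lives in the source copy and becomes b ^ p in the target, where b is
    -- therefore a root.
    h (Polynomial.X ^ p - Polynomial.C b) (Polynomial.X_pow_sub_C_ne_zero hp0 b) b
      (by simp [frobenius_def])
  exact PerfectRing.toPerfectField _ p

section

variable {A B C : Type u} [(lang n).Structure A] [(theory n).Model A] [(lang n).Structure B]
  [(theory n).Model B] [(lang n).Structure C] [(theory n).Model C]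

/-- A p-th root taken in B is algebraic over A, hence already in A. -/
theorem perfectField_of_isRelAlgClosedIn [PerfectField (FieldOf n B)] (e : A ↪[lang n] B)
    (he : IsRelAlgClosedIn e.toHom.range) : PerfectField (FieldOf n A) := by
  obtain ⟨p, hp⟩ := ExpChar.exists (FieldOf n A)
  have : ExpChar (FieldOf n B) p := expChar_of_injective_ringHom (ringHomOf e).injective p
  have hp0 : 0 < p := expChar_pos (FieldOf n A) p
  have : PerfectRing (FieldOf n A) p := PerfectRing.ofSurjective _ p fun a => by
    obtain ⟨b, hb⟩ := surjective_frobenius (FieldOf n B) p (ringHomOf e a)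
    rw [frobenius_def] at hb
    obtain ⟨c, rfl⟩ := (isRelAlgClosedIn_range_iff e).1 he (Polynomial.X ^ p - Polynomial.C a)
      (Polynomial.X_pow_sub_C_ne_zero hp0 a) b (by simp [hb])
    exact ⟨c, (ringHomOf e).injective ((map_pow (ringHomOf e) c p).trans hb)⟩
  exact PerfectRing.toPerfectField _ p

/-- Models amalgamate over a perfect common submodel that is relatively algebraically closed in
one of them. -/
theorem exists_amalgam [PerfectField (FieldOf n A)] (e : A ↪[lang n] B)
    (he : IsRelAlgClosedIn e.toHom.range) (e' : A ↪[lang n] C) :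
    ∃ (D : Type u) (_ : (lang n).Structure D) (_ : (theory n).Model D) (g : B ↪[lang n] D)
      (g' : C ↪[lang n] D), ∀ a, g (e a) = g' (e' a) := by
  let _ : Algebra (FieldOf n A) (FieldOf n B) := (ringHomOf e).toAlgebra
  let _ : Algebra (FieldOf n A) (FieldOf n C) := (ringHomOf e').toAlgebra
  have : IsIntegrallyClosedIn (FieldOf n A) (FieldOf n B) := by
    refine isIntegrallyClosedIn_iff.2 ⟨(ringHomOf e).injective, fun {b} hb => ?_⟩
    obtain ⟨p, hp, hpb⟩ := hb
    exact (isRelAlgClosedIn_range_iff e).1 he p hp.ne_zero b hpb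
  obtain ⟨D, _, δ, f, g, hδ, hf, hg, hfg⟩ := exists_fractionRing_amalgam
    (k := FieldOf n A) (B := FieldOf n B) (C := FieldOf n C) (autEquiv A) (autEquiv B) (autEquiv C)
    (fun i a => (ringHomOf_autEquiv e i a).symm) (fun i a => (ringHomOf_autEquiv e' i a).symm)
    (autEquiv_comm B) (autEquiv_comm C)
  obtain ⟨M, _, _, ε, hε⟩ := exists_model_of_field δ hδ
  obtain ⟨φ, hφ⟩ := exists_embedding_of_ringHom (ε.toRingHom.comp f) fun i x => by
    simp [hf, hε]
  obtain ⟨ψ, hψ⟩ := exists_embedding_of_ringHom (ε.toRingHom.comp g) fun i x => by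
    simp [hg, hε]
  refine ⟨M, inferInstance, inferInstance, φ, ψ, fun a => ?_⟩
  exact (hφ (e a)).trans ((congrArg ε (hfg a)).trans (hψ (e' a)).symm)

/-- Every model embeds into a relatively algebraically closed one. -/
theorem exists_isRelAlgClosedModel (A : Type u) [(lang n).Structure A] [(theory n).Model A] :
    ∃ (M : Type u) (_ : (lang n).Structure M),
      IsRelAlgClosedModel (n := n) M ∧ Nonempty (A ↪[lang n] M) := by
  obtain ⟨F, _, τ, g, hτ, hg, hF⟩ := exists_maximal_algebraic_extension
    (autEquiv (n := n) A) (autEquiv_comm A)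
  obtain ⟨M, _, _, ε, hε⟩ := exists_model_of_field τ hτ
  obtain ⟨φ, -⟩ := exists_embedding_of_ringHom (ε.toRingHom.comp g) fun i x => by
    simp [hg, hε]
  refine ⟨M, inferInstance, ⟨inferInstance, fun N _ _ f => ?_⟩, ⟨φ⟩⟩
  refine (isRelAlgClosedIn_range_iff f).2 fun p hp b hb => ?_
  obtain ⟨a, ha⟩ := hF (FieldOf n N) inferInstance (autEquiv N) ((ringHomOf f).comp ε.toRingHom)
    (autEquiv_comm N) (fun i x => by simp [hε, ringHomOf_autEquiv]) (p.map ε.symm.toRingHom)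
    ((Polynomial.map_ne_zero_iff ε.symm.injective).2 hp) b (by
      rw [Polynomial.eval₂_map, ← hb]
      congr 1
      ext x
      simp)
  exact ⟨ε a, ha⟩

/-- A model that is relatively algebraically closed in a relatively algebraically closed model is
itself a relatively algebraically closed model. -/
theorem IsRelAlgClosedModel.of_isRelAlgClosedIn (hB : IsRelAlgClosedModel (n := n) B)
    (e : A ↪[lang n] B) (he : IsRelAlgClosedIn e.toHom.range) :
    IsRelAlgClosedModel (n := n) A := by
  refine ⟨inferInstance, fun N _ _ h => (isRelAlgClosedIn_range_iff h).2 fun p hp b hb => ?_⟩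
  have := hB.perfectField
  have := perfectField_of_isRelAlgClosedIn e he
  -- In D, the image of b is algebraic over B and so comes from some c in B; c is a root of p, so it
  -- comes from A.
  obtain ⟨D, _, _, g, g', hgg⟩ := exists_amalgam e he h
  have hcomp : (ringHomOf g).comp (ringHomOf e) = (ringHomOf g').comp (ringHomOf h) :=
    RingHom.ext hgg
  have hroot : p.eval₂ ((ringHomOf g).comp (ringHomOf e)) (ringHomOf g' b) = 0 := by
    rw [hcomp, ← Polynomial.hom_eval₂, hb, map_zero]
  obtain ⟨c, hc⟩ := (isRelAlgClosedIn_range_iff g).1 (hB.2 D g) (p.map (ringHomOf e))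
    ((Polynomial.map_ne_zero_iff (ringHomOf e).injective).2 hp) (ringHomOf g' b)
    (by rw [Polynomial.eval₂_map, hroot])
  rw [← hc, ← Polynomial.hom_eval₂, map_eq_zero] at hroot
  obtain ⟨a, rfl⟩ := (isRelAlgClosedIn_range_iff e).1 he p hp c hroot
  exact ⟨a, (ringHomOf g').injective ((hgg a).symm.trans hc)⟩

end

theorem IsRelAlgClosedModel.of_equiv {A B : Type u} [(lang n).Structure A] [(lang n).Structure B]
    (hA : IsRelAlgClosedModel (n := n) A) (e : A ≃[lang n] B) :
    IsRelAlgClosedModel (n := n) B := by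
  have := hA.1
  refine ⟨Theory.IsUniversal.models_of_embedding e.symm.toEmbedding, fun N _ _ f => ?_⟩
  have h : (f.comp e.toEmbedding).toHom.range = f.toHom.range := by
    ext x
    constructor
    · rintro ⟨a, rfl⟩
      exact ⟨e a, rfl⟩
    · rintro ⟨b, rfl⟩
      exact ⟨e.symm b, congrArg f (e.apply_symm_apply b)⟩
  exact h ▸ hA.2 N (f.comp e.toEmbedding)

/-- Embeddings between members of the class are strong. -/
theorem isStrongEmbedding_fcaClass {A₀ B C : Bundled.{u} (lang n).Structure}
    (hB : B ∈ (fcaClass A₀).carrier) (hC : C ∈ (fcaClass A₀).carrier) (f : B ↪[lang n] C) :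
    (fcaClass A₀).IsStrongEmbedding f :=
  ⟨⟨hB.1.of_equiv f.equivRange, hB.2.map f.equivRange.toEmbedding.comp⟩, hC⟩

theorem amalgamatesOver_fcaClass {A₀ : Bundled.{u} (lang n).Structure}
    (h₀ : IsRelAlgClosedModel (n := n) A₀) : (fcaClass A₀).AmalgamatesOver A₀ := by
  intro B hB C hC f f' _ _
  have := h₀.1
  have := hB.1.1
  have := hC.1.1
  have := h₀.perfectField
  -- A₀ is relatively algebraically closed in every extension, in particular in B.
  obtain ⟨D, _, _, g, g', hg⟩ := exists_amalgam f (h₀.2 B f) f'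
  obtain ⟨M, _, hM, ⟨j⟩⟩ := exists_isRelAlgClosedModel (n := n) D
  let M' : Bundled (lang n).Structure := ⟨M, inferInstance⟩
  have hMem : M' ∈ (fcaClass A₀).carrier := ⟨hM, ⟨(j.comp g).comp f⟩⟩
  exact ⟨M', hMem, j.comp g, j.comp g', isStrongEmbedding_fcaClass hB hMem _,
    isStrongEmbedding_fcaClass hC hMem _, Embedding.ext fun a => congrArg j (hg a)⟩

theorem jointEmbeddingProperty_fcaClass {A₀ : Bundled.{u} (lang n).Structure}
    (h₀ : IsRelAlgClosedModel (n := n) A₀) : (fcaClass A₀).JointEmbeddingProperty := by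
  intro B hB C hC
  have hA₀ : A₀ ∈ (fcaClass A₀).carrier := ⟨h₀, ⟨Embedding.refl _ _⟩⟩
  obtain ⟨f⟩ := hB.2
  obtain ⟨f'⟩ := hC.2
  obtain ⟨D, hD, g, g', hg, hg', -⟩ := amalgamatesOver_fcaClass h₀ B hB C hC f f'
    (isStrongEmbedding_fcaClass hA₀ hB f) (isStrongEmbedding_fcaClass hA₀ hC f')
  exact ⟨D, hD, g, g', hg, hg'⟩

theorem isRelAlgClosedModel_acl {A : Type u} [(lang n).Structure A] [(theory n).Model A]
    (hA : IsRelAlgClosedModel (n := n) A) (X : Set A) :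
    IsRelAlgClosedModel (n := n) (acl (n := n) A X) := by
  refine hA.of_isRelAlgClosedIn (acl (n := n) A X).subtype ?_
  rw [Substructure.range_subtype]
  exact (isLeast_acl A X).1.2

end Amalgamation

end FCA

theorem mainTheorem5 (n : ℕ) (A : Type u) [(FCA.lang n).Structure A]
    [(FCA.theory n).Model A] (hA : FCA.IsRelAlgClosedModel (n := n) A) :
    let A₀ : CategoryTheory.Bundled.{u} (FCA.lang n).Structure :=
      CategoryTheory.Bundled.of (FCA.acl (n := n) A ∅)
    A₀ ∈ (FCA.fcaClass A₀).carrier ∧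
      (FCA.fcaClass A₀).AmalgamatesOver A₀ ∧
      (FCA.fcaClass A₀).JointEmbeddingProperty := by
  intro A₀
  have h₀ : FCA.IsRelAlgClosedModel (n := n) A₀ := FCA.isRelAlgClosedModel_acl hA ∅
  exact ⟨⟨h₀, ⟨FirstOrder.Language.Embedding.refl _ _⟩⟩, FCA.amalgamatesOver_fcaClass h₀,
    FCA.jointEmbeddingProperty_fcaClass h₀⟩
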